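/- **Setting.** Let $\mathbb U$ be a mathematical universe (any collection of objects that contains the functions $\mathbb R\to\mathbb C$), and let $\mathcal F$ be the set of its finite subsets, directed by inclusion. Let $\mathbb R^*\supsetneq\mathbb R$ be an ordered field with a $\Lambda$-limit: every net $\varphi:\mathcal F\to\mathbb R$ has a limit $\lim_\lambda\varphi(\lambda)\in\mathbb R^*$, every element of $\mathbb R^*$ is such a limit, limits respect sums and products, and a net that is equal to $r\in\mathbb R$ for all $\lambda\supseteq\lambda_0$ has limit $r$. A set $Q\subseteq\mathcal F$ is qualified if the limit of a net depends only on its values on $Q$. Put $\mathbb C^*=\mathbb R^*+i\mathbb R^*$ and take limits of complex nets componentwise. The limit of a net of functions $f_\lambda:\mathbb R\to\mathbb C$ is the function $\mathbb R^*\to\mathbb C^*$ with $\lim_\lambda x_\lambda\mapsto\lim_\lambda f_\lambda(x_\lambda)$. Write $f^*$ for the limit of the constant net $f$, and put $\int^*\lim_\lambda f_\lambda=\lim_\lambda\int f_\lambda$ for integrable $f_\lambda$. The limit of a net of finite sets $A_\lambda\subset\mathbb R$ is the hyperfinite set of all $\lim_\lambda x_\lambda$ with $x_\lambda\in A_\lambda$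 for $\lambda$ in a qualified set. If $S=\lim_\lambda A_\lambda$, and $g=\lim_\lambda\gamma_\lambda$ on $S$, the hyperfinite sum is $\sum_{k\in S}g(k)=\lim_\lambda\sum_{t\in A_\lambda}\gamma_\lambda(t)$. Let $V^{\mathfrak F}(\mathbb R)=H^1(\mathbb R)\cap L^2(\mathbb R,|x|^2)$ (complex functions, continuous representatives), let $V_\lambda=\mathrm{Span}_{\mathbb C}(V^{\mathfrak F}(\mathbb R)\cap\lambda)$, and let the space of ultrafunctions $\widetilde V$ be the set of all limits of nets $f_\lambda\in V_\lambda$. A basis of $\widetilde V$ indexed by a hyperfinite set is a family that is the $\Lambda$-limit of bases of the spaces $V_\lambda$ ($\lambda$ in a qualified set). For $u\in\widetilde V$ let $\hat u(k)=\frac1{\sqrt{2\pi}}\int^*u(x)e^{-ikx}\,dx$. Assume the Fourier transform axiom: if $u\in\widetilde V$, then $\hat u\in\widetilde V$ and $\bar u\in\widetilde V$. For $k\in\mathbb R^*$ let $\widetilde{e^{ikx}}\in\widetilde V$ be the ultrafunction with $\int^*\widetilde{e^{ikx}}\,v\,dx=\int^*e^{ikx}v\,dx$ for all $v\in\widetilde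 V$. For $q\in\mathbb R^*$ let $\delta_q\in\widetilde V$ be the ultrafunction with $\int^*v\,\delta_q\,dx=v(q)$ for all $v\in\widetilde V$. Let $\Sigma\subset\mathbb R^*$ be a hyperfinite set such that $\{\delta_a\}_{a\in\Sigma}$ is a basis of $\widetilde V$, and let $\{\sigma_a\}_{a\in\Sigma}\subset\widetilde V$ be its dual basis, $\int^*\delta_a\sigma_b\,dx=\delta_{ab}$ (Kronecker symbol). **Theorem (Fourier expansion).** 1. For every $u\in\widetilde V$, and in particular for $u=f^*$ with $f\in V^{\mathfrak F}(\mathbb R)$ (in which case $f^*\in\widetilde V$), and for all $x\in\mathbb R^*$, $$u(x)=\frac1{\sqrt{2\pi}}\sum_{k\in\Sigma}c_k\,\widetilde{e^{ikx}},\qquad c_k=\int^*\hat u(\xi)\,\sigma_k(\xi)\,d\xi,$$ where the sum is a hyperfinite sum. 2. The family $\left\{\widetilde{e^{ikx}}/\sqrt{2\pi}\right\}_{k\in\Sigma}$ is a basis of $\widetilde V$. The family $\{\widehat{\sigma_k}(-x)\}_{k\in\Sigma}$ is a basis of $\widetilde V$ too, and it is the dual basis for the scalar product $(u,v)=\int^*u\,\bar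 v\,dx$: $$\int^*\frac{\widetilde{e^{ikx}}}{\sqrt{2\pi}}\;\overline{\widehat{\sigma_b}(-x)}\,dx=\delta_{kb}\qquad(k,b\in\Sigma).$$ -/

import Mathlib

open MeasureTheory Filter
open scoped ContDiff

/-- The axioms of the `Λ`-limit.  `U` is the mathematical universe, `Finset U` the directed set of
its finite subsets, and `K` is an ordered field containing `ℝ`.  Every real net indexed by the
finite subsets of `U` has a limit in `K`. -/
structure LambdaLimit (U K : Type*) [Field K] [LinearOrder K] [IsStrictOrderedRing K]
    [Algebra ℝ K] where
  /-- the `Λ`-limit of a real net -/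
  lim : (Finset U → ℝ) → K
  /-- `K` is a superreal field: it extends `ℝ` properly -/
  proper : ∃ ξ : K, ∀ r : ℝ, algebraMap ℝ K r ≠ ξ
  /-- every element of `K` is a `Λ`-limit -/
  lim_surjective : Function.Surjective lim
  /-- eventually constant nets have the expected limit -/
  lim_of_eventually_const : ∀ (φ : Finset U → ℝ) (r : ℝ) (s₀ : Finset U),
    (∀ s, s₀ ⊆ s → φ s = r) → lim φ = algebraMap ℝ K r
  lim_add : ∀ φ ψ : Finset U → ℝ, lim φ + lim ψ = lim (fun s => φ s + ψ s)
  lim_mul : ∀ φ ψ : Finset U → ℝ, lim φ * lim ψ = lim (fun s => φ s * ψ s)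

/-- The field `ℂ* = K + iK`. -/
abbrev HyperComplex (K : Type*) [Field K] : Type _ := QuadraticAlgebra K (-1) 0

namespace LambdaLimit

variable {U K : Type*} [Field K] [LinearOrder K] [IsStrictOrderedRing K] [Algebra ℝ K]
  (L : LambdaLimit U K)

/-! ### Qualified sets -/

/-- A set of indices is qualified if the `Λ`-limit of a net depends only on the values of the net
on this set. -/
def Qualified (Q : Set (Finset U)) : Prop :=
  ∀ φ ψ : Finset U → ℝ, (∀ s ∈ Q, φ s = ψ s) → L.lim φ = L.lim ψ

lemma lim_zero : L.lim (fun _ => 0) = 0 := by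
  simpa using L.lim_of_eventually_const (fun _ => 0) 0 ∅ (fun _ _ => rfl)

lemma lim_one : L.lim (fun _ => 1) = 1 := by
  simpa using L.lim_of_eventually_const (fun _ => 1) 1 ∅ (fun _ _ => rfl)

lemma qualified_of_lim_eq {φ ψ : Finset U → ℝ} (h : L.lim φ = L.lim ψ) :
    L.Qualified {s | φ s = ψ s} := by
  intro f g hfg
  have hd : L.lim (fun s => φ s - ψ s) = 0 := by
    have h1 := L.lim_add (fun s => φ s - ψ s) ψ
    simp only [sub_add_cancel] at h1
    have h2 : L.lim (fun s => φ s) = L.lim ψ := h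
    rw [h2] at h1
    simpa using h1
  have h3 := L.lim_mul (fun s => φ s - ψ s) (fun s => (f s - g s) / (φ s - ψ s))
  have h4 : (fun s => (φ s - ψ s) * ((f s - g s) / (φ s - ψ s))) = fun s => f s - g s := by
    funext s
    by_cases hs : φ s = ψ s
    · have := hfg s hs
      simp [hs, this]
    · have : φ s - ψ s ≠ 0 := sub_ne_zero.2 hs
      field_simp
  rw [h4, hd, zero_mul] at h3
  have h5 := L.lim_add (fun s => f s - g s) g
  simp only [sub_add_cancel] at h5
  rw [← h3, zero_add] at h5
  exact h5.symm

lemma Qualified.mono {Q R : Set (Finset U)} (hQ : L.Qualified Q) (h : Q ⊆ R) : L.Qualified R :=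
  fun φ ψ hφ => hQ φ ψ fun s hs => hφ s (h hs)

lemma Qualified.inter {Q R : Set (Finset U)} (hQ : L.Qualified Q) (hR : L.Qualified R) :
    L.Qualified (Q ∩ R) := by
  classical
  intro f g h
  have h1 : L.lim f = L.lim (fun s => if s ∈ Q then f s else g s) :=
    hQ _ _ fun s hs => by simp [hs]
  rw [h1]
  refine hR _ _ fun s hs => ?_
  by_cases hq : s ∈ Q
  · simp [hq, h s ⟨hq, hs⟩]
  · simp [hq]

lemma not_qualified_empty : ¬ L.Qualified ∅ := by
  intro h
  have := h (fun _ => 0) (fun _ => 1) (fun s hs => hs.elim)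
  rw [L.lim_zero, L.lim_one] at this
  exact zero_ne_one this

lemma qualified_or_compl (Q : Set (Finset U)) : L.Qualified Q ∨ L.Qualified Qᶜ := by
  classical
  have h := L.lim_mul (fun s => if s ∈ Q then 0 else 1) (fun s => if s ∈ Q then 1 else 0)
  have h1 : (fun s => (if s ∈ Q then (0 : ℝ) else 1) * (if s ∈ Q then 1 else 0)) = fun _ => 0 := by
    funext s
    by_cases hs : s ∈ Q <;> simp [hs]
  rw [h1, L.lim_zero] at h
  rcases mul_eq_zero.1 h with h | h
  · rw [← L.lim_zero] at h
    refine Or.inl ((L.qualified_of_lim_eq h).mono L fun s hs => ?_)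
    by_contra hq
    simp [hq] at hs
  · rw [← L.lim_zero] at h
    refine Or.inr ((L.qualified_of_lim_eq h).mono L fun s hs => ?_)
    intro hq
    simp [hq] at hs

/-! ### Limits of complex nets and of nets of functions, sets and operators -/

/-- The `Λ`-limit of a complex net. -/
def limC (c : Finset U → ℂ) : HyperComplex K :=
  ⟨L.lim fun s => (c s).re, L.lim fun s => (c s).im⟩

lemma limC_congr {c d : Finset U → ℂ} (h : L.Qualified {s | c s = d s}) : L.limC c = L.limC d := by
  unfold limC
  congr 1
  · exact h _ _ fun s hs => congrArg Complex.re hs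
  · exact h _ _ fun s hs => congrArg Complex.im hs

lemma qualified_of_limC_eq {c d : Finset U → ℂ} (h : L.limC c = L.limC d) :
    L.Qualified {s | c s = d s} := by
  have h1 := L.qualified_of_lim_eq (congrArg QuadraticAlgebra.re h)
  have h2 := L.qualified_of_lim_eq (congrArg QuadraticAlgebra.im h)
  exact (h1.inter L h2).mono L fun s hs => Complex.ext hs.1 hs.2

/-- A real net with `Λ`-limit `ξ`. -/
noncomputable def rep (ξ : K) : Finset U → ℝ := (L.lim_surjective ξ).choose

lemma lim_rep (ξ : K) : L.lim (L.rep ξ) = ξ := (L.lim_surjective ξ).choose_spec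

/-- The internal function `K → ℂ*` which is the `Λ`-limit of a net of functions `ℝ → ℂ`; its value
at `lim x_s` is `lim f_s(x_s)`, see `limFun_lim`. -/
noncomputable def limFun (f : Finset U → ℝ → ℂ) (ξ : K) : HyperComplex K :=
  L.limC fun s => f s (L.rep ξ s)

lemma limFun_lim (f : Finset U → ℝ → ℂ) (x : Finset U → ℝ) :
    L.limFun f (L.lim x) = L.limC fun s => f s (x s) :=
  L.limC_congr <| (L.qualified_of_lim_eq (L.lim_rep (L.lim x))).mono L fun s hs =>
    congrArg (f s) hs

lemma qualified_of_limFun_eq {f g : Finset U → ℝ → ℂ} (h : L.limFun f = L.limFun g) :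
    L.Qualified {s | f s = g s} := by
  classical
  let x : Finset U → ℝ := fun s => if hs : ∃ t, f s t ≠ g s t then hs.choose else 0
  have h1 := congrFun h (L.lim x)
  rw [limFun_lim, limFun_lim] at h1
  refine (L.qualified_of_limC_eq h1).mono L fun s hs => ?_
  by_contra hne
  have hex : ∃ t, f s t ≠ g s t := Function.ne_iff.1 hne
  have hx : x s = hex.choose := dif_pos hex
  apply hex.choose_spec
  have hs' : f s (x s) = g s (x s) := hs
  rwa [hx] at hs'

/-- The natural extension `f* : K → ℂ*` of a function `f : ℝ → ℂ`. -/
noncomputable def natExt (f : ℝ → ℂ) : K → HyperComplex K := L.limFun fun _ => f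

open Classical in
/-- The natural extension `∫*` of the Lebesgue integral `L¹(ℝ) → ℂ`: if `u` is the `Λ`-limit of
integrable functions `f_s` then `∫* u` is the `Λ`-limit of `∫ f_s`
(see `starIntegral_limFun`). -/
noncomputable def starIntegral (u : K → HyperComplex K) : HyperComplex K :=
  if h : ∃ f : Finset U → ℝ → ℂ, (∀ s, Integrable (f s)) ∧ L.limFun f = u then
    L.limC fun s => ∫ x, h.choose s x
  else 0

lemma starIntegral_limFun (f : Finset U → ℝ → ℂ) (hf : ∀ s, Integrable (f s)) :
    L.starIntegral (L.limFun f) = L.limC fun s => ∫ x, f s x := by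
  have h : ∃ g : Finset U → ℝ → ℂ, (∀ s, Integrable (g s)) ∧ L.limFun g = L.limFun f :=
    ⟨f, hf, rfl⟩
  rw [starIntegral, dif_pos h]
  refine L.limC_congr ((L.qualified_of_limFun_eq h.choose_spec.2).mono L fun s hs => ?_)
  have hs' : h.choose s = f s := hs
  show ∫ x, h.choose s x = ∫ x, f s x
  rw [hs']

/-- The hyperfinite set which is the `Λ`-limit of a net of finite sets of reals. -/
def limSet (A : Finset U → Finset ℝ) : Set K :=
  {ξ | ∃ x : Finset U → ℝ, L.Qualified {s | x s ∈ A s} ∧ L.lim x = ξ}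

lemma qualified_of_limSet_subset {A B : Finset U → Finset ℝ} (h : L.limSet A ⊆ L.limSet B) :
    L.Qualified {s | A s ⊆ B s} := by
  classical
  rcases L.qualified_or_compl {s | A s ⊆ B s} with hq | hq
  · exact hq
  exfalso
  let x : Finset U → ℝ := fun s => if hs : ∃ t, t ∈ A s ∧ t ∉ B s then hs.choose else 0
  have hx : ∀ s ∈ {s | A s ⊆ B s}ᶜ, x s ∈ A s ∧ x s ∉ B s := by
    intro s hs
    have hex : ∃ t, t ∈ A s ∧ t ∉ B s := Finset.not_subset.1 hs
    have hxs : x s = hex.choose := dif_pos hex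
    rw [hxs]
    exact hex.choose_spec
  obtain ⟨y, hy, hyx⟩ := h ⟨x, hq.mono L fun s hs => (hx s hs).1, rfl⟩
  refine L.not_qualified_empty
    (((hq.inter L hy).inter L (L.qualified_of_lim_eq hyx)).mono L fun s hs => ?_)
  have h1 : y s = x s := hs.2
  have h2 : y s ∈ B s := hs.1.2
  exact (hx s hs.1.1).2 (h1 ▸ h2)

/-- `HasHyperSum S g c`: the set `S` is hyperfinite, `g` is internal on `S`, and the hyperfinite
sum of `g` over `S` is `c`. That is, `S = lim A_s` with `A_s` finite, `g = lim γ_s` on `S`, and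
`c = lim ∑_{t ∈ A_s} γ_s(t)`. -/
def HasHyperSum (S : Set K) (g : K → HyperComplex K) (c : HyperComplex K) : Prop :=
  ∃ (A : Finset U → Finset ℝ) (γ : Finset U → ℝ → ℂ), L.limSet A = S ∧
    (∀ ξ ∈ S, g ξ = L.limFun γ ξ) ∧ c = L.limC fun s => ∑ t ∈ A s, γ s t

/-- Hyperfinite sums are well defined. -/
lemma HasHyperSum.unique {S : Set K} {g : K → HyperComplex K} {c d : HyperComplex K}
    (hc : L.HasHyperSum S g c) (hd : L.HasHyperSum S g d) : c = d := by
  classical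
  obtain ⟨A, γ, hA, hγ, rfl⟩ := hc
  obtain ⟨B, η, hB, hη, rfl⟩ := hd
  have hAB := (L.qualified_of_limSet_subset (hA.trans hB.symm).le).inter L
    (L.qualified_of_limSet_subset (hB.trans hA.symm).le)
  have hge : L.Qualified {s | ∀ t ∈ A s, γ s t = η s t} := by
    rcases L.qualified_or_compl {s | ∀ t ∈ A s, γ s t = η s t} with hq | hq
    · exact hq
    exfalso
    let x : Finset U → ℝ := fun s => if hs : ∃ t, t ∈ A s ∧ γ s t ≠ η s t then hs.choose else 0
    have hx : ∀ s ∈ {s | ∀ t ∈ A s, γ s t = η s t}ᶜ, x s ∈ A s ∧ γ s (x s) ≠ η s (x s) := by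
      intro s hs
      have hex : ∃ t, t ∈ A s ∧ γ s t ≠ η s t := by
        simpa using hs
      have hxs : x s = hex.choose := dif_pos hex
      rw [hxs]
      exact hex.choose_spec
    have hmem : L.lim x ∈ S := hA ▸ ⟨x, hq.mono L fun s hs => (hx s hs).1, rfl⟩
    have heq := (hγ _ hmem).symm.trans (hη _ hmem)
    rw [limFun_lim, limFun_lim] at heq
    exact L.not_qualified_empty
      ((hq.inter L (L.qualified_of_limC_eq heq)).mono L fun s hs => (hx s hs.1).2 hs.2)
  refine L.limC_congr ((hAB.inter L hge).mono L fun s hs => ?_)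
  have hs1 : A s = B s := Finset.Subset.antisymm hs.1.1 hs.1.2
  have hs2 : ∀ t ∈ A s, γ s t = η s t := hs.2
  show ∑ t ∈ A s, γ s t = ∑ t ∈ B s, η s t
  rw [← hs1]
  exact Finset.sum_congr rfl hs2

end LambdaLimit

/-! ### The function space -/

/-- The space `H¹(ℝ) ∩ L²(ℝ, |x|²)` of complex functions, each class being represented by its
continuous representative. -/
def fourierSpace : Submodule ℂ (ℝ → ℂ) where
  carrier := {u | Continuous u ∧ MemLp u 2 ∧ MemLp (fun x : ℝ => (x : ℂ) * u x) 2 ∧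
    ∃ g : ℝ → ℂ, MemLp g 2 ∧ ∀ φ : ℝ → ℂ, ContDiff ℝ ∞ φ → HasCompactSupport φ →
      ∫ x, u x * deriv φ x = -∫ x, g x * φ x}
  zero_mem' := ⟨continuous_const, MemLp.zero, by simp, 0, MemLp.zero, by simp⟩
  add_mem' := by
    rintro u v ⟨hu, hu2, hux, g, hg, hgu⟩ ⟨hv, hv2, hvx, k, hk, hkv⟩
    refine ⟨hu.add hv, hu2.add hv2, ?_, g + k, hg.add hk, fun φ hφ hc => ?_⟩
    · have := hux.add hvx
      refine this.congr_norm ?_ ?_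
      · exact (Complex.continuous_ofReal.mul (hu.add hv)).aestronglyMeasurable
      · exact Eventually.of_forall fun x => by simp [mul_add]
    · have hd : Continuous (deriv φ) := hφ.continuous_deriv (by simp)
      have hφ2 : MemLp φ 2 := hφ.continuous.memLp_of_hasCompactSupport hc
      have i1 : Integrable fun x => u x * deriv φ x :=
        (hu.mul hd).integrable_of_hasCompactSupport hc.deriv.mul_left
      have i2 : Integrable fun x => v x * deriv φ x :=
        (hv.mul hd).integrable_of_hasCompactSupport hc.deriv.mul_left
      have i3 : Integrable fun x => g x * φ x := hg.integrable_mul hφ2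
      have i4 : Integrable fun x => k x * φ x := hk.integrable_mul hφ2
      simp only [Pi.add_apply, add_mul]
      rw [integral_add i1 i2, integral_add i3 i4, hgu φ hφ hc, hkv φ hφ hc]
      ring
  smul_mem' := by
    rintro c u ⟨hu, hu2, hux, g, hg, hgu⟩
    refine ⟨hu.const_smul c, hu2.const_smul c, ?_, c • g, hg.const_smul c, fun φ hφ hc => ?_⟩
    · refine (hux.const_smul c).congr_norm ?_ ?_
      · exact (Complex.continuous_ofReal.mul (hu.const_smul c)).aestronglyMeasurable
      · exact Eventually.of_forall fun x => by
          simp only [Pi.smul_apply, smul_eq_mul, norm_mul]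
          ring
    · simp only [Pi.smul_apply, smul_eq_mul, mul_assoc]
      rw [integral_const_mul, integral_const_mul, hgu φ hφ hc]
      ring

/-! ### Ultrafunctions

Here `ι` expresses that the universe `U` contains the functions `ℝ → ℂ`. -/

namespace LambdaLimit

variable {U K : Type*} [Field K] [LinearOrder K] [IsStrictOrderedRing K] [Algebra ℝ K]
  (L : LambdaLimit U K) (ι : (ℝ → ℂ) ↪ U)

/-- The finite-dimensional space `V_s = Span (V ∩ s)` for a finite subset `s` of the universe. -/
def spanIn (ι : (ℝ → ℂ) ↪ U) (s : Finset U) : Submodule ℂ (ℝ → ℂ) :=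
  Submodule.span ℂ {f | f ∈ fourierSpace ∧ ι f ∈ s}

/-- The space of ultrafunctions: the `Λ`-limit of the spaces `V_s`. -/
def ultrafunctions : Set (K → HyperComplex K) :=
  {u | ∃ f : Finset U → ℝ → ℂ, (∀ s, f s ∈ spanIn ι s) ∧ L.limFun f = u}

/-- The function `e^{ikx}` of the variable `x ∈ K`, for `k ∈ K`, where the exponential is the
natural extension of `t ↦ e^{it}`. -/
noncomputable def planeWave (k : K) : K → HyperComplex K :=
  fun x => L.natExt (fun t => Complex.exp (Complex.I * t)) (k * x)

/-- The number `1/√(2π)`, as an element of `K`. -/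
noncomputable def invSqrtTwoPi (K : Type*) [Field K] [Algebra ℝ K] : K :=
  algebraMap ℝ K (1 / Real.sqrt (2 * Real.pi))

/-- The Fourier transform `û(k) = (1/√(2π)) ∫* u(x) e^{-ikx} dx`. -/
noncomputable def starFourier (u : K → HyperComplex K) : K → HyperComplex K :=
  fun k => invSqrtTwoPi K • L.starIntegral fun x => u x * L.planeWave (-k) x

/-- The Fourier transform axiom: the space of ultrafunctions is closed under the Fourier transform
and under complex conjugation. -/
def FourierTransformAxiom : Prop :=
  ∀ u ∈ L.ultrafunctions ι,
    L.starFourier u ∈ L.ultrafunctions ι ∧ (fun x => star (u x)) ∈ L.ultrafunctions ι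

/-- `w` is an ultrafunction `f̃` associated to the internal function `f`. -/
def IsTilde (f w : K → HyperComplex K) : Prop :=
  w ∈ L.ultrafunctions ι ∧
    ∀ v ∈ L.ultrafunctions ι, L.starIntegral (fun x => f x * v x) =
      L.starIntegral (fun x => w x * v x)

/-- The ultrafunction `f̃`. -/
noncomputable def tilde (f : K → HyperComplex K) : K → HyperComplex K :=
  Classical.epsilon (L.IsTilde ι f)

/-- `d` is a Delta ultrafunction concentrated in `q`. -/
def IsDelta (q : K) (d : K → HyperComplex K) : Prop :=
  d ∈ L.ultrafunctions ι ∧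
    ∀ v ∈ L.ultrafunctions ι, L.starIntegral (fun x => v x * d x) = v q

/-- The Delta ultrafunction `δ_q`. -/
noncomputable def delta (q : K) : K → HyperComplex K :=
  Classical.epsilon (L.IsDelta ι q)

/-- `{b_a}_{a ∈ S}` is a basis of the hyperfinite dimensional space of ultrafunctions: it is the
`Λ`-limit of bases `{β_s(t)}_{t ∈ A_s}` of the spaces `V_s`. In particular `S` is hyperfinite. -/
def IsHyperBasis (S : Set K) (b : K → K → HyperComplex K) : Prop :=
  ∃ (A : Finset U → Finset ℝ) (β : Finset U → ℝ → ℝ → ℂ), L.limSet A = S ∧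
    (∀ a : Finset U → ℝ, L.lim a ∈ S → b (L.lim a) = L.limFun fun s => β s (a s)) ∧
    L.Qualified {s | LinearIndepOn ℂ (β s) (A s : Set ℝ) ∧
      Submodule.span ℂ (β s '' (A s : Set ℝ)) = spanIn ι s}

/-- `S` is a set of independent points: `{δ_a}_{a ∈ S}` is a Delta-basis. -/
def IsIndependentPoints (S : Set K) : Prop := L.IsHyperBasis ι S (L.delta ι)

open Classical in
/-- The Kronecker symbol. -/
noncomputable def kronecker (a b : K) : HyperComplex K := if a = b then 1 else 0

/-- `w` is an element with index `b` of the basis dual to `{δ_a}_{a ∈ S}`. -/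
def IsSigma (S : Set K) (b : K) (w : K → HyperComplex K) : Prop :=
  w ∈ L.ultrafunctions ι ∧
    ∀ a ∈ S, L.starIntegral (fun x => L.delta ι a x * w x) = kronecker a b

/-- The element `σ_b` of the Sigma-basis, the dual basis of the Delta-basis `{δ_a}_{a ∈ S}`. -/
noncomputable def sigma (S : Set K) (b : K) : K → HyperComplex K :=
  Classical.epsilon (L.IsSigma ι S b)

/-- The scalar product `(u, v) = ∫* u(x) conj(v(x)) dx`. -/
noncomputable def scalarProduct (u v : K → HyperComplex K) : HyperComplex K :=
  L.starIntegral fun x => u x * star (v x)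

/-- The coefficient `∫* û(ξ) σ_k(ξ) dξ`. -/
noncomputable def fourierCoeff (S : Set K) (u : K → HyperComplex K) (k : K) : HyperComplex K :=
  L.starIntegral fun ξ => L.starFourier u ξ * L.sigma ι S k ξ

/-- `u(x) = (1/√(2π)) ∑_{k ∈ S} c_k ẽ^{ikx}` for all `x`, where `c_k = ∫* û σ_k` and the sum is a
hyperfinite sum. -/
def HasFourierExpansion (S : Set K) (u : K → HyperComplex K) : Prop :=
  ∀ x : K, ∃ c : HyperComplex K,
    L.HasHyperSum S (fun k => L.fourierCoeff ι S u k * L.tilde ι (L.planeWave k) x) c ∧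
      u x = invSqrtTwoPi K • c

end LambdaLimit

/-! ### Analysis in `fourierSpace` -/

/-! The qualified sets form an ultrafilter, so an identity between `Λ`-limits is an identity between
nets on a qualified set, and the theorem reduces to linear algebra in a single `V = spanIn ι s`. The
Fourier transform axiom descends as well: for a qualified set of `s` the space `V` is closed under
the transform `F` and under conjugation (`qualified_fourierClosed`).

Closure under conjugation makes the bilinear pairing `∫ f g` nondegenerate on `V`, hence evaluation
at `k` is represented by some `δ_k ∈ V`. Closure under `F` makes `F` an automorphism of `V`,
symmetric for this pairing. For `v ∈ V`, `∫ e^{ikx} v = √(2π) (F⁻¹v)(k) = √(2π) ∫ δ_k F⁻¹v = √(2π) ∫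
(F⁻¹δ_k) v`, so the projection of `e^{ikx}` to `V` is `√(2π) F⁻¹δ_k` (`integral_exp_mul`). The
normalized waves are thus the image of the Delta-basis under `F⁻¹`: they form a basis, and the
expansion of `f` is `F⁻¹` applied to the expansion of `F f` in the `δ_k` (`expansion`). Duality
follows because `σ_b` is real, which gives `conj (F⁻¹σ_b) = F σ_b`, and `F` can be moved across the
pairing (`integral_fourierInv_mul_star`).

To return to `K`, the objects selected by `Classical.epsilon` are shown to be unique and equal to
limits of their finite-level counterparts: `delta_lim`, `tilde_planeWave_lim`, `sigma_lim`. -/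

lemma continuous_of_mem_fourierSpace {f : ℝ → ℂ} (hf : f ∈ fourierSpace) : Continuous f := hf.1

/-- The squared norm is `1/(1 + x²)`. This is the weight that turns the moment condition into
integrability. -/
lemma memLp_two_inv_one_add_I_mul :
    MemLp (fun x : ℝ => (1 + Complex.I * (x : ℂ))⁻¹) 2 := by
  have hne : ∀ x : ℝ, 1 + Complex.I * (x : ℂ) ≠ 0 := fun x h => by
    simpa using congrArg Complex.re h
  have hc : Continuous fun x : ℝ => (1 + Complex.I * (x : ℂ))⁻¹ :=
    Continuous.inv₀ (by fun_prop) hne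
  rw [memLp_two_iff_integrable_sq_norm hc.aestronglyMeasurable]
  refine integrable_inv_one_add_sq.congr (Eventually.of_forall fun x => ?_)
  simp only [norm_inv, inv_pow]
  rw [← Complex.normSq_eq_norm_sq]
  simp [Complex.normSq_apply, pow_two]

/-- Write `f = (f + i x f) · (1 + i x)⁻¹`, a product of two `L²` functions. -/
lemma integrable_of_mem_fourierSpace {f : ℝ → ℂ} (hf : f ∈ fourierSpace) : Integrable f := by
  have h1 : MemLp (fun x : ℝ => f x + Complex.I * ((x : ℂ) * f x)) 2 :=
    hf.2.1.add (hf.2.2.1.const_mul Complex.I)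
  refine (h1.integrable_mul memLp_two_inv_one_add_I_mul).congr (Eventually.of_forall fun x => ?_)
  have hne : 1 + Complex.I * (x : ℂ) ≠ 0 := fun h => by
    simpa using congrArg Complex.re h
  simp only [Pi.mul_apply]
  field_simp

lemma integrable_mul_of_mem_fourierSpace {f g : ℝ → ℂ} (hf : f ∈ fourierSpace)
    (hg : g ∈ fourierSpace) : Integrable fun x => f x * g x :=
  hf.2.1.integrable_mul hg.2.1

/-- A vanishing `L²` norm only gives `f = 0` almost everywhere; continuity upgrades this to every
point. -/
lemma eq_zero_of_integral_mul_star {f : ℝ → ℂ} (hf : f ∈ fourierSpace)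
    (h : ∫ x, star (f x) * f x = 0) : f = 0 := by
  have h1 : ∀ x, star (f x) * f x = ((‖f x‖ ^ 2 : ℝ) : ℂ) := fun x => by
    have := Complex.conj_mul' (f x)
    push_cast
    exact this
  simp only [h1] at h
  rw [integral_complex_ofReal, Complex.ofReal_eq_zero] at h
  have hc : Continuous fun x => ‖f x‖ ^ 2 := by
    have := continuous_of_mem_fourierSpace hf
    fun_prop
  have h2 := (integral_eq_zero_iff_of_nonneg (fun x => by positivity)
    ((memLp_two_iff_integrable_sq_norm hf.1.aestronglyMeasurable).1 hf.2.1)).1 h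
  have h3 := (hc.ae_eq_iff_eq volume continuous_const).1 h2
  funext x
  have h4 : ‖f x‖ ^ 2 = 0 := congrFun h3 x
  simpa using h4

/-! ### The Fourier transform with the normalization `(1/√(2π)) ∫ f(x) e^{-ikx} dx` -/

/-- The unitary Fourier transform. -/
noncomputable def unitaryFourier (f : ℝ → ℂ) (k : ℝ) : ℂ :=
  ((1 / Real.sqrt (2 * Real.pi) : ℝ) : ℂ) *
    ∫ x, f x * Complex.exp (Complex.I * ((-k * x : ℝ) : ℂ))

/-- The inverse unitary Fourier transform. -/
noncomputable def unitaryFourierInv (f : ℝ → ℂ) (x : ℝ) : ℂ := unitaryFourier f (-x)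

lemma norm_exp_I_mul_ofReal (x : ℝ) : ‖Complex.exp (Complex.I * (x : ℂ))‖ = 1 := by
  rw [mul_comm, Complex.norm_exp_ofReal_mul_I]

lemma integrable_mul_exp {f : ℝ → ℂ} (hf : Integrable f) (k : ℝ) :
    Integrable fun x : ℝ => f x * Complex.exp (Complex.I * ((k * x : ℝ) : ℂ)) :=
  hf.mul_bdd (c := 1) (Continuous.aestronglyMeasurable (by fun_prop))
    (Eventually.of_forall fun x => (norm_exp_I_mul_ofReal _).le)

/-- The form with the character `e^{ix}` gives access to the symmetry of the transform under the
integral pairing. -/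
lemma unitaryFourier_eq_vectorFourier (f : ℝ → ℂ) (k : ℝ) :
    unitaryFourier f k = ((1 / Real.sqrt (2 * Real.pi) : ℝ) : ℂ) *
      VectorFourier.fourierIntegral Real.probChar volume (LinearMap.mul ℝ ℝ) f k := by
  rw [unitaryFourier, VectorFourier.fourierIntegral_probChar]
  congr 1
  refine integral_congr_ae (Eventually.of_forall fun x => ?_)
  simp only [LinearMap.mul_apply', smul_eq_mul]
  rw [mul_comm]
  congr 2
  push_cast
  ring

/-- Fubini: the kernel `e^{-ikx}` is symmetric in `k` and `x`, so flipping the bilinear form changes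
nothing. -/
lemma integral_unitaryFourier_mul {f g : ℝ → ℂ} (hf : Integrable f) (hg : Integrable g) :
    ∫ x, unitaryFourier f x * g x = ∫ x, f x * unitaryFourier g x := by
  have h := VectorFourier.integral_fourierIntegral_smul_eq_flip (μ := volume) (ν := volume)
    (L := LinearMap.mul ℝ ℝ) Real.continuous_probChar (by simpa using! continuous_mul) hf hg
  have hflip : (LinearMap.mul ℝ ℝ).flip = LinearMap.mul ℝ ℝ := by
    ext; simp
  rw [hflip] at h
  simp only [unitaryFourier_eq_vectorFourier, smul_eq_mul] at h ⊢
  simp only [mul_assoc, mul_left_comm (f _)]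
  rw [integral_const_mul, integral_const_mul, h]

/-- Rescaling to the kernel `e^{-2πikx}`, for which the inversion theorem is available. -/
lemma unitaryFourier_eq_fourier (f : ℝ → ℂ) (k : ℝ) :
    unitaryFourier f k = ((1 / Real.sqrt (2 * Real.pi) : ℝ) : ℂ) *
      FourierTransform.fourier f (k / (2 * Real.pi)) := by
  rw [unitaryFourier, Real.fourier_real_eq_integral_exp_smul]
  congr 1
  refine integral_congr_ae (Eventually.of_forall fun x => ?_)
  simp only [smul_eq_mul]
  rw [mul_comm]
  congr 2
  have : (Real.pi : ℂ) ≠ 0 := by simp [Real.pi_ne_zero]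
  push_cast
  field_simp

lemma unitaryFourierInv_unitaryFourier {f : ℝ → ℂ} (hc : Continuous f) (hf : Integrable f)
    (hF : Integrable (unitaryFourier f)) : unitaryFourierInv (unitaryFourier f) = f := by
  have hpi : (0 : ℝ) < 2 * Real.pi := by positivity
  have hs : Real.sqrt (2 * Real.pi) ≠ 0 := by positivity
  have hfour : FourierTransform.fourier f = fun w : ℝ =>
      (Real.sqrt (2 * Real.pi) : ℂ) * unitaryFourier f (w * (2 * Real.pi)) := by
    funext w
    rw [unitaryFourier_eq_fourier, mul_div_cancel_right₀ _ hpi.ne', ← mul_assoc,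
      ← Complex.ofReal_mul, mul_one_div_cancel hs, Complex.ofReal_one, one_mul]
  have hi : Integrable (FourierTransform.fourier f) := by
    rw [hfour]
    exact (hF.comp_mul_right' hpi.ne').const_mul _
  have hinv := Continuous.fourierInv_fourier_eq hc hf hi
  conv_rhs => rw [← hinv]
  funext x
  rw [Real.fourierInv_eq_fourier_neg, Real.fourier_real_eq_integral_exp_smul, hfour,
    unitaryFourierInv, unitaryFourier]
  have h := Measure.integral_comp_mul_right (fun y : ℝ => unitaryFourier f y *
    Complex.exp (Complex.I * ((- -x * y : ℝ) : ℂ))) (2 * Real.pi)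
  have h2 : ∫ v : ℝ, Complex.exp (((-2 * Real.pi * v * -x : ℝ) : ℂ) * Complex.I) •
      ((Real.sqrt (2 * Real.pi) : ℂ) * unitaryFourier f (v * (2 * Real.pi))) =
      (Real.sqrt (2 * Real.pi) : ℂ) * ∫ v : ℝ, unitaryFourier f (v * (2 * Real.pi)) *
        Complex.exp (Complex.I * ((- -x * (v * (2 * Real.pi)) : ℝ) : ℂ)) := by
    rw [← integral_const_mul]
    refine integral_congr_ae (Eventually.of_forall fun v => ?_)
    simp only [smul_eq_mul]
    rw [mul_comm, mul_assoc]
    congr 3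
    push_cast
    ring
  -- The substitution contributes `1/(2π)`, and `√(2π)/(2π)` is exactly the normalizing constant.
  rw [h2, h, abs_of_pos (inv_pos.2 hpi), Complex.real_smul, ← mul_assoc, ← Complex.ofReal_mul]
  congr 2
  rw [← Real.sqrt_div_self']
  rw [div_eq_mul_inv]

/-- The substitution `y ↦ -y` in the outer integral turns this into the inversion in the other
order. -/
lemma unitaryFourier_unitaryFourierInv {f : ℝ → ℂ} (hc : Continuous f) (hf : Integrable f)
    (hF : Integrable (unitaryFourier f)) : unitaryFourier (unitaryFourierInv f) = f := by
  have h := unitaryFourierInv_unitaryFourier hc hf hF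
  conv_rhs => rw [← h]
  funext x
  have h2 := integral_neg_eq_self (μ := (volume : Measure ℝ)) (fun y : ℝ => unitaryFourier f y *
    Complex.exp (Complex.I * ((- -x * y : ℝ) : ℂ)))
  simp only [unitaryFourierInv]
  rw [unitaryFourier, unitaryFourier, ← h2]
  simp only [neg_neg, neg_mul, mul_neg, unitaryFourierInv]

/-- Conjugation flips the sign of the exponent. Hence closure under the transform and conjugation
already yields closure under the inverse transform. -/
lemma star_unitaryFourier (f : ℝ → ℂ) :
    (fun x => star (unitaryFourier (fun y => star (f y)) x)) = unitaryFourierInv f := by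
  funext x
  simp only [unitaryFourierInv, unitaryFourier, star_mul']
  congr 1
  · simp
  · rw [← starRingEnd_apply, ← integral_conj]
    refine integral_congr_ae (Eventually.of_forall fun v => ?_)
    simp only [map_mul, starRingEnd_apply, star_star]
    congr 1
    rw [← starRingEnd_apply, ← Complex.exp_conj]
    simp

lemma unitaryFourierInv_sum {α : Type*} (A : Finset α) (c : α → ℂ) (d : α → ℝ → ℂ)
    (hd : ∀ t ∈ A, Integrable (d t)) :
    unitaryFourierInv (∑ t ∈ A, c t • d t) = ∑ t ∈ A, c t • unitaryFourierInv (d t) := by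
  funext x
  simp only [unitaryFourierInv, unitaryFourier, Finset.sum_apply, Pi.smul_apply, smul_eq_mul,
    Finset.sum_mul, mul_assoc]
  rw [integral_finsetSum _ fun t ht => (integrable_mul_exp (hd t ht) _).const_mul _,
    Finset.mul_sum]
  refine Finset.sum_congr rfl fun t _ => ?_
  rw [integral_const_mul]
  ring

/-! ### Finite-dimensional spaces closed under the Fourier transform and conjugation -/

/-- A finite-dimensional subspace of `fourierSpace` which is closed under the Fourier transform
and complex conjugation. -/
structure FourierClosed (V : Submodule ℂ (ℝ → ℂ)) : Prop where
  le : V ≤ fourierSpace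
  finite : FiniteDimensional ℂ V
  star_mem : ∀ f ∈ V, (fun x => star (f x)) ∈ V
  fourier_mem : ∀ f ∈ V, unitaryFourier f ∈ V

namespace FourierClosed

variable {V : Submodule ℂ (ℝ → ℂ)} (hV : FourierClosed V)
include hV

lemma continuous {f : ℝ → ℂ} (hf : f ∈ V) : Continuous f :=
  continuous_of_mem_fourierSpace (hV.le hf)

lemma integrable {f : ℝ → ℂ} (hf : f ∈ V) : Integrable f :=
  integrable_of_mem_fourierSpace (hV.le hf)

lemma integrable_mul {f g : ℝ → ℂ} (hf : f ∈ V) (hg : g ∈ V) : Integrable fun x => f x * g x :=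
  integrable_mul_of_mem_fourierSpace (hV.le hf) (hV.le hg)

lemma fourierInv_mem {f : ℝ → ℂ} (hf : f ∈ V) : unitaryFourierInv f ∈ V := by
  rw [← star_unitaryFourier]
  exact hV.star_mem _ (hV.fourier_mem _ (hV.star_mem _ hf))

lemma fourierInv_fourier {f : ℝ → ℂ} (hf : f ∈ V) :
    unitaryFourierInv (unitaryFourier f) = f :=
  unitaryFourierInv_unitaryFourier (hV.continuous hf) (hV.integrable hf)
    (hV.integrable (hV.fourier_mem f hf))

lemma fourier_fourierInv {f : ℝ → ℂ} (hf : f ∈ V) :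
    unitaryFourier (unitaryFourierInv f) = f :=
  unitaryFourier_unitaryFourierInv (hV.continuous hf) (hV.integrable hf)
    (hV.integrable (hV.fourier_mem f hf))

lemma integral_fourier_mul {f g : ℝ → ℂ} (hf : f ∈ V) (hg : g ∈ V) :
    ∫ x, unitaryFourier f x * g x = ∫ x, f x * unitaryFourier g x :=
  integral_unitaryFourier_mul (hV.integrable hf) (hV.integrable hg)

/-- Test against `v = conj f`, which lies in `V`; this is how conjugation makes the bilinear pairing
nondegenerate. -/
lemma eq_zero_of_integral_mul {f : ℝ → ℂ} (hf : f ∈ V) (h : ∀ v ∈ V, ∫ x, v x * f x = 0) :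
    f = 0 :=
  eq_zero_of_integral_mul_star (hV.le hf) (h _ (hV.star_mem f hf))

lemma eq_of_integral_mul {f g : ℝ → ℂ} (hf : f ∈ V) (hg : g ∈ V)
    (h : ∀ v ∈ V, ∫ x, v x * f x = ∫ x, v x * g x) : f = g := by
  refine sub_eq_zero.1 (hV.eq_zero_of_integral_mul (V.sub_mem hf hg) fun v hv => ?_)
  simp only [Pi.sub_apply, mul_sub]
  rw [integral_sub (hV.integrable_mul hv hf) (hV.integrable_mul hv hg), h v hv, sub_self]

/-- Riesz representation for the bilinear pairing: nondegeneracy makes `V → V*` injective, and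
equality of dimensions makes it surjective. -/
lemma exists_integral_mul_eq (l : V →ₗ[ℂ] ℂ) :
    ∃ w ∈ V, ∀ v : V, ∫ x, (v : ℝ → ℂ) x * w x = l v := by
  have := hV.finite
  let B : V →ₗ[ℂ] Module.Dual ℂ V :=
    LinearMap.mk₂ ℂ (fun w v : V => ∫ x, (v : ℝ → ℂ) x * (w : ℝ → ℂ) x)
      (fun w w' v => by
        simp only [Submodule.coe_add, Pi.add_apply, mul_add]
        exact integral_add (hV.integrable_mul v.2 w.2) (hV.integrable_mul v.2 w'.2))
      (fun c w v => by
        simp only [Submodule.coe_smul, Pi.smul_apply, smul_eq_mul]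
        rw [← integral_const_mul]
        simp only [mul_left_comm])
      (fun w v v' => by
        simp only [Submodule.coe_add, Pi.add_apply, add_mul]
        exact integral_add (hV.integrable_mul v.2 w.2) (hV.integrable_mul v'.2 w.2))
      (fun c w v => by
        simp only [Submodule.coe_smul, Pi.smul_apply, smul_eq_mul]
        rw [← integral_const_mul]
        simp only [mul_assoc])
  have hinj : Function.Injective B := by
    rw [← LinearMap.ker_eq_bot, LinearMap.ker_eq_bot']
    intro w hw
    exact Subtype.ext (hV.eq_zero_of_integral_mul w.2 fun v hv => LinearMap.congr_fun hw ⟨v, hv⟩)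
  obtain ⟨w, hw⟩ := (LinearMap.injective_iff_surjective_of_finrank_eq_finrank
    (Subspace.dual_finrank_eq (K := ℂ) (V := V)).symm).1 hinj l
  exact ⟨w, w.2, fun v => LinearMap.congr_fun hw v⟩

end FourierClosed

/-! ### Delta functions, interpolating functions and bases in a finite-dimensional space. -/

open Classical in
/-- The element of `V` which represents the evaluation at `q`, if it exists. -/
noncomputable def deltaIn (V : Submodule ℂ (ℝ → ℂ)) (q : ℝ) : ℝ → ℂ :=
  if h : ∃ w ∈ V, ∀ v ∈ V, ∫ x, v x * w x = v q then h.choose else 0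

open Classical in
/-- The element of `V` which is `1` at `b` and `0` at the other points of `A`, if it exists. -/
noncomputable def sigmaIn (V : Submodule ℂ (ℝ → ℂ)) (A : Finset ℝ) (b : ℝ) : ℝ → ℂ :=
  if h : ∃ w ∈ V, ∀ a ∈ A, w a = if a = b then 1 else 0 then h.choose else 0

lemma deltaIn_mem (V : Submodule ℂ (ℝ → ℂ)) (q : ℝ) : deltaIn V q ∈ V := by
  unfold deltaIn
  split_ifs with h
  exacts [h.choose_spec.1, V.zero_mem]

lemma sigmaIn_mem (V : Submodule ℂ (ℝ → ℂ)) (A : Finset ℝ) (b : ℝ) : sigmaIn V A b ∈ V := by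
  unfold sigmaIn
  split_ifs with h
  exacts [h.choose_spec.1, V.zero_mem]

/-- `{d_t}_{t ∈ A}` is a basis of `V`. -/
def IsBasisOn (V : Submodule ℂ (ℝ → ℂ)) (A : Finset ℝ) (d : ℝ → ℝ → ℂ) : Prop :=
  LinearIndepOn ℂ d (A : Set ℝ) ∧ Submodule.span ℂ (d '' (A : Set ℝ)) = V

namespace IsBasisOn

variable {V : Submodule ℂ (ℝ → ℂ)} {A : Finset ℝ} {d : ℝ → ℝ → ℂ}

lemma mem (h : IsBasisOn V A d) {t : ℝ} (ht : t ∈ A) : d t ∈ V :=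
  h.2 ▸ Submodule.subset_span ⟨t, ht, rfl⟩

lemma card_eq (h : IsBasisOn V A d) : A.card = Module.finrank ℂ V := by
  have h1 := finrank_span_eq_card (R := ℂ) (b := fun t : (A : Set ℝ) => d t) h.1
  rw [← Set.image_eq_range, h.2] at h1
  simpa using h1.symm

lemma of_card [FiniteDimensional ℂ V] (hd : ∀ t ∈ A, d t ∈ V)
    (hi : LinearIndepOn ℂ d (A : Set ℝ)) (hA : A.card = Module.finrank ℂ V) :
    IsBasisOn V A d := by
  refine ⟨hi, Submodule.eq_of_le_of_finrank_eq ?_ ?_⟩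
  · rw [Submodule.span_le]
    rintro _ ⟨t, ht, rfl⟩
    exact hd t ht
  · have h1 := finrank_span_eq_card (R := ℂ) (b := fun t : (A : Set ℝ) => d t) hi
    rw [← Set.image_eq_range] at h1
    rw [h1, ← hA]
    simp

lemma exists_eq_sum (h : IsBasisOn V A d) {f : ℝ → ℂ} (hf : f ∈ V) :
    ∃ c : ℝ → ℂ, f = ∑ t ∈ A, c t • d t := by
  classical
  rw [← h.2, Submodule.mem_span_image_finset_iff_exists_fun] at hf
  obtain ⟨c, hc⟩ := hf
  refine ⟨fun t => if ht : t ∈ A then c ⟨t, ht⟩ else 0, ?_⟩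
  rw [← hc, ← Finset.sum_coe_sort A]
  simp

lemma congr {e : ℝ → ℝ → ℂ} (h : IsBasisOn V A d) (he : ∀ t ∈ A, d t = e t) :
    IsBasisOn V A e :=
  ⟨h.1.congr he, by rw [← h.2, Set.image_congr he]⟩

end IsBasisOn

/-! ### Fourier expansion and duality at a finite level. -/

namespace FourierClosed

variable {V : Submodule ℂ (ℝ → ℂ)} (hV : FourierClosed V) {A : Finset ℝ}
include hV

lemma integral_mul_deltaIn (q : ℝ) {v : ℝ → ℂ} (hv : v ∈ V) :
    ∫ x, v x * deltaIn V q x = v q := by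
  have h : ∃ w ∈ V, ∀ v ∈ V, ∫ x, v x * w x = v q := by
    obtain ⟨w, hw, h⟩ := hV.exists_integral_mul_eq ((LinearMap.proj q).comp V.subtype)
    exact ⟨w, hw, fun v hv => h ⟨v, hv⟩⟩
  rw [deltaIn, dif_pos h]
  exact h.choose_spec.2 v hv

lemma integral_deltaIn_mul (q : ℝ) {v : ℝ → ℂ} (hv : v ∈ V) :
    ∫ x, deltaIn V q x * v x = v q := by
  rw [← hV.integral_mul_deltaIn q hv]
  simp only [mul_comm]

/-- The value at `a` is the pairing with `δ_a`, so `f` is orthogonal to a spanning set of `V`. -/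
lemma eq_zero_of_forall_mem (hA : IsBasisOn V A (deltaIn V)) {f : ℝ → ℂ} (hf : f ∈ V)
    (h : ∀ a ∈ A, f a = 0) : f = 0 := by
  refine hV.eq_zero_of_integral_mul hf fun v hv => ?_
  obtain ⟨c, rfl⟩ := hA.exists_eq_sum hv
  simp only [Finset.sum_apply, Pi.smul_apply, smul_eq_mul, Finset.sum_mul, mul_assoc]
  rw [integral_finsetSum _ fun t ht =>
    (hV.integrable_mul (deltaIn_mem V t) hf).const_mul _]
  refine Finset.sum_eq_zero fun t ht => ?_
  rw [integral_const_mul, hV.integral_deltaIn_mul t hf, h t ht, mul_zero]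

lemma eq_of_forall_mem (hA : IsBasisOn V A (deltaIn V)) {f g : ℝ → ℂ} (hf : f ∈ V) (hg : g ∈ V)
    (h : ∀ a ∈ A, f a = g a) : f = g :=
  sub_eq_zero.1 <| hV.eq_zero_of_forall_mem hA (V.sub_mem hf hg) fun a ha => by
    simp [h a ha]

/-- The interpolation problem is solvable: evaluation `V → ℂ^A` is injective and `A.card` is the
dimension of `V`. -/
lemma sigmaIn_apply (hA : IsBasisOn V A (deltaIn V)) {a : ℝ} (ha : a ∈ A) (b : ℝ) :
    sigmaIn V A b a = if a = b then 1 else 0 := by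
  have hfin := hV.finite
  let ev : V →ₗ[ℂ] (A → ℂ) :=
    LinearMap.pi fun a => (LinearMap.proj (a : ℝ)).comp V.subtype
  have hinj : Function.Injective ev := by
    rw [← LinearMap.ker_eq_bot, LinearMap.ker_eq_bot']
    intro w hw
    exact Subtype.ext (hV.eq_zero_of_forall_mem hA w.2 fun a ha => congrFun hw ⟨a, ha⟩)
  have hrank : Module.finrank ℂ V = Module.finrank ℂ (A → ℂ) := by
    rw [← hA.card_eq]
    simp
  have h : ∃ w ∈ V, ∀ a ∈ A, w a = if a = b then 1 else 0 := by
    obtain ⟨w, hw⟩ := (LinearMap.injective_iff_surjective_of_finrank_eq_finrank hrank).1 hinj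
      fun a => if (a : ℝ) = b then 1 else 0
    exact ⟨w, w.2, fun a ha => congrFun hw ⟨a, ha⟩⟩
  rw [sigmaIn, dif_pos h]
  exact h.choose_spec.2 a ha

lemma integral_deltaIn_mul_sigmaIn (hA : IsBasisOn V A (deltaIn V)) {a : ℝ} (ha : a ∈ A)
    (b : ℝ) : ∫ x, deltaIn V a x * sigmaIn V A b x = if a = b then 1 else 0 := by
  rw [hV.integral_deltaIn_mul a (sigmaIn_mem V A b), hV.sigmaIn_apply hA ha]

lemma isBasisOn_sigmaIn (hA : IsBasisOn V A (deltaIn V)) : IsBasisOn V A (sigmaIn V A) := by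
  have hfin := hV.finite
  refine IsBasisOn.of_card (fun t _ => sigmaIn_mem V A t) ?_ hA.card_eq
  rw [linearIndepOn_finset_iff]
  intro c hc a ha
  have h := congrFun hc a
  simp only [Finset.sum_apply, Pi.smul_apply, smul_eq_mul, Pi.zero_apply,
    hV.sigmaIn_apply hA ha] at h
  simpa [ha] using h

/-- Applying the transform to a vanishing combination recovers the same combination of the `d t`;
the dimension count does the rest. -/
lemma isBasisOn_fourierInv {d : ℝ → ℝ → ℂ} (hd : IsBasisOn V A d) :
    IsBasisOn V A fun t => unitaryFourierInv (d t) := by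
  have hfin := hV.finite
  refine IsBasisOn.of_card (fun t ht => hV.fourierInv_mem (hd.mem ht)) ?_ hd.card_eq
  rw [linearIndepOn_finset_iff]
  intro c hc
  rw [← unitaryFourierInv_sum _ _ _ fun t ht => hV.integrable (hd.mem ht)] at hc
  have h := hV.fourier_fourierInv (V.sum_mem fun t ht => V.smul_mem (c t) (hd.mem ht))
  rw [hc] at h
  refine linearIndepOn_finset_iff.1 hd.1 c (h.symm.trans ?_)
  funext x
  simp [unitaryFourier]

/-- Expand the transform of `f` in the Delta-basis, read off the coefficients by pairing with the
dual basis, and apply the inverse transform term by term. -/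
lemma expansion (hA : IsBasisOn V A (deltaIn V)) {f : ℝ → ℂ} (hf : f ∈ V) :
    f = ∑ t ∈ A, (∫ x, unitaryFourier f x * sigmaIn V A t x) •
      unitaryFourierInv (deltaIn V t) := by
  obtain ⟨c, hc⟩ := hA.exists_eq_sum (hV.fourier_mem f hf)
  have hc' : ∀ b ∈ A, ∫ x, unitaryFourier f x * sigmaIn V A b x = c b := by
    intro b hb
    rw [hc]
    simp only [Finset.sum_apply, Pi.smul_apply, smul_eq_mul, Finset.sum_mul, mul_assoc]
    rw [integral_finsetSum _ fun t ht =>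
      (hV.integrable_mul (deltaIn_mem V t) (sigmaIn_mem V A b)).const_mul _]
    rw [Finset.sum_congr rfl fun t ht => by
      rw [integral_const_mul, hV.integral_deltaIn_mul_sigmaIn hA ht]]
    simp [hb]
  rw [Finset.sum_congr rfl fun t ht => by rw [hc' t ht],
    ← unitaryFourierInv_sum _ _ _ fun t ht => hV.integrable (deltaIn_mem V t), ← hc,
    hV.fourierInv_fourier hf]

/-- The left side is `√(2π)` times the inverse transform of `v` at `k`, that is, its pairing with
`δ_k`; symmetry moves the inverse transform onto `δ_k`. -/
lemma integral_exp_mul (k : ℝ) {v : ℝ → ℂ} (hv : v ∈ V) :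
    ∫ x, Complex.exp (Complex.I * ((k * x : ℝ) : ℂ)) * v x =
      ∫ x, (Real.sqrt (2 * Real.pi) : ℂ) * unitaryFourierInv (deltaIn V k) x * v x := by
  have hs : (Real.sqrt (2 * Real.pi) : ℝ) ≠ 0 := by positivity
  have h1 : ∫ x, Complex.exp (Complex.I * ((k * x : ℝ) : ℂ)) * v x =
      (Real.sqrt (2 * Real.pi) : ℂ) * unitaryFourierInv v k := by
    rw [unitaryFourierInv, unitaryFourier, ← mul_assoc, ← Complex.ofReal_mul,
      mul_one_div_cancel hs, Complex.ofReal_one, one_mul, neg_neg]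
    simp only [mul_comm]
  have h2 := hV.integral_deltaIn_mul k (hV.fourierInv_mem hv)
  have h3 := hV.integral_fourier_mul (hV.fourierInv_mem (deltaIn_mem V k)) (hV.fourierInv_mem hv)
  rw [hV.fourier_fourierInv (deltaIn_mem V k), hV.fourier_fourierInv hv, h2] at h3
  simp only [mul_assoc]
  rw [integral_const_mul, ← h3, h1]

/-- Both sides lie in `V` and have the same values, 0 or 1, on `A`, which determines them. -/
lemma star_sigmaIn (hA : IsBasisOn V A (deltaIn V)) (b : ℝ) :
    (fun x => star (sigmaIn V A b x)) = sigmaIn V A b :=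
  hV.eq_of_forall_mem hA (hV.star_mem _ (sigmaIn_mem V A b)) (sigmaIn_mem V A b) fun a ha => by
    simp only [hV.sigmaIn_apply hA ha]
    split_ifs <;> simp

/-- Since `σ_b` is real, the conjugate of its inverse transform is its transform, which moves to the
first factor and cancels the inverse there. What remains is the pairing of `δ_a` with `σ_b`. -/
lemma integral_fourierInv_mul_star (hA : IsBasisOn V A (deltaIn V)) {a : ℝ} (ha : a ∈ A)
    (b : ℝ) : ∫ x, unitaryFourierInv (deltaIn V a) x * star (unitaryFourierInv (sigmaIn V A b) x) =
      if a = b then 1 else 0 := by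
  have h1 : ∀ x, star (unitaryFourierInv (sigmaIn V A b) x) = unitaryFourier (sigmaIn V A b) x := by
    intro x
    rw [← star_unitaryFourier, star_star, hV.star_sigmaIn hA]
  simp only [h1]
  rw [← hV.integral_fourier_mul (hV.fourierInv_mem (deltaIn_mem V a)) (sigmaIn_mem V A b),
    hV.fourier_fourierInv (deltaIn_mem V a), hV.integral_deltaIn_mul_sigmaIn hA ha]

end FourierClosed

namespace LambdaLimit

variable {U K : Type*} [Field K] [LinearOrder K] [IsStrictOrderedRing K] [Algebra ℝ K]
  (L : LambdaLimit U K)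

/-! ### Algebra of `Λ`-limits -/

lemma lim_const (r : ℝ) : L.lim (fun _ => r) = algebraMap ℝ K r :=
  L.lim_of_eventually_const _ r ∅ fun _ _ => rfl

lemma lim_neg (φ : Finset U → ℝ) : L.lim (fun s => -φ s) = -L.lim φ := by
  refine eq_neg_of_add_eq_zero_left ?_
  rw [L.lim_add, ← L.lim_zero]
  simp

lemma lim_sub (φ ψ : Finset U → ℝ) : L.lim (fun s => φ s - ψ s) = L.lim φ - L.lim ψ := by
  simp only [sub_eq_add_neg]
  rw [← L.lim_neg, L.lim_add]

lemma qualified_univ : L.Qualified Set.univ := fun φ ψ h => by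
  rw [funext fun s => h s trivial]

lemma qualified_of_forall {p : Finset U → Prop} (h : ∀ s, p s) : L.Qualified {s | p s} :=
  L.qualified_univ.mono L fun s _ => h s

lemma qualified_superset (s₀ : Finset U) : L.Qualified {s | s₀ ⊆ s} := by
  intro φ ψ h
  have := L.lim_of_eventually_const (fun s => φ s - ψ s) 0 s₀ fun s hs => sub_eq_zero.2 (h s hs)
  rw [L.lim_sub, map_zero] at this
  exact sub_eq_zero.1 this

/-- A property which holds on a qualified set for every choice of parameters holds uniformly in
the parameter on a qualified set. -/
lemma qualified_forall {α : Type*} [Nonempty α] {p : Finset U → α → Prop}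
    (h : ∀ x : Finset U → α, L.Qualified {s | p s (x s)}) : L.Qualified {s | ∀ t, p s t} := by
  classical
  -- The hypothesis is applied to a net that picks a counterexample wherever one exists.
  refine (h fun s => if hs : ∃ t, ¬ p s t then hs.choose else Classical.arbitrary α).mono L
    fun s hs => ?_
  by_contra hne
  have hex : ∃ t, ¬ p s t := not_forall.1 hne
  rw [Set.mem_ofPred_eq, dif_pos hex] at hs
  exact hex.choose_spec hs

lemma limC_mul (c d : Finset U → ℂ) : L.limC c * L.limC d = L.limC fun s => c s * d s := by
  ext
  · simp [limC, L.lim_mul, sub_eq_add_neg, ← L.lim_add, L.lim_neg]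
  · simp [limC, L.lim_mul, ← L.lim_add]

lemma limC_star (c : Finset U → ℂ) : star (L.limC c) = L.limC fun s => star (c s) := by
  ext <;> simp [limC, L.lim_neg]

lemma limC_smul (r : ℝ) (c : Finset U → ℂ) :
    algebraMap ℝ K r • L.limC c = L.limC fun s => (r : ℂ) * c s := by
  ext <;> simp [limC, ← L.lim_mul, L.lim_const, Algebra.smul_def]

lemma limC_zero : L.limC (fun _ => 0) = 0 := by
  ext <;> simp [limC, L.lim_zero]

lemma limC_one : L.limC (fun _ => 1) = 1 := by
  ext <;> simp [limC, L.lim_zero, L.lim_one, QuadraticAlgebra.re_one, QuadraticAlgebra.im_one]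

lemma limC_ite (a b : Finset U → ℝ) :
    L.limC (fun s => if a s = b s then 1 else 0) = kronecker (L.lim a) (L.lim b) := by
  unfold kronecker
  split_ifs with h
  · rw [← L.limC_one]
    exact L.limC_congr ((L.qualified_of_lim_eq h).mono L fun s hs => if_pos hs)
  · rw [← L.limC_zero]
    refine L.limC_congr ?_
    -- If the limits differ, the agreement set is not qualified, so its complement is.
    rcases L.qualified_or_compl {s | a s = b s} with hq | hq
    · exact absurd (hq a b fun s hs => hs) h
    · exact hq.mono L fun s hs => if_neg hs

lemma limFun_congr {f g : Finset U → ℝ → ℂ} (h : L.Qualified {s | f s = g s}) :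
    L.limFun f = L.limFun g :=
  funext fun _ => L.limC_congr (h.mono L fun _ hs => congrFun hs _)

lemma limFun_mul (f g : Finset U → ℝ → ℂ) :
    (fun x => L.limFun f x * L.limFun g x) = L.limFun fun s x => f s x * g s x :=
  funext fun _ => L.limC_mul _ _

lemma limFun_star (f : Finset U → ℝ → ℂ) :
    (fun x => star (L.limFun f x)) = L.limFun fun s x => star (f s x) :=
  funext fun _ => L.limC_star _

lemma limFun_smul (r : ℝ) (f : Finset U → ℝ → ℂ) :
    (fun x => algebraMap ℝ K r • L.limFun f x) = L.limFun fun s x => (r : ℂ) * f s x :=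
  funext fun _ => L.limC_smul _ _

lemma limFun_neg (f : Finset U → ℝ → ℂ) :
    (fun x => L.limFun f (-x)) = L.limFun fun s x => f s (-x) := by
  funext ξ
  obtain ⟨x, rfl⟩ := L.lim_surjective ξ
  rw [← L.lim_neg, limFun_lim, limFun_lim]

lemma starIntegral_limFun_of_qualified (f : Finset U → ℝ → ℂ)
    (hf : L.Qualified {s | Integrable (f s)}) :
    L.starIntegral (L.limFun f) = L.limC fun s => ∫ x, f s x := by
  classical
  have h1 : L.Qualified {s | f s = if Integrable (f s) then f s else 0} :=
    hf.mono L fun s hs => (if_pos hs).symm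
  rw [L.limFun_congr h1, L.starIntegral_limFun]
  · refine L.limC_congr (hf.mono L fun s hs => ?_)
    have hs' : Integrable (f s) := hs
    simp [hs']
  · intro s
    split_ifs with h
    exacts [h, integrable_zero _ _ _]

lemma starIntegral_mul (f g : Finset U → ℝ → ℂ)
    (h : L.Qualified {s | Integrable fun x => f s x * g s x}) :
    L.starIntegral (fun x => L.limFun f x * L.limFun g x) = L.limC fun s => ∫ x, f s x * g s x := by
  rw [limFun_mul, L.starIntegral_limFun_of_qualified _ h]

lemma planeWave_lim (k : Finset U → ℝ) :
    L.planeWave (L.lim k) = L.limFun fun s x => Complex.exp (Complex.I * ((k s * x : ℝ) : ℂ)) := by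
  funext ξ
  obtain ⟨x, rfl⟩ := L.lim_surjective ξ
  rw [planeWave, natExt, L.lim_mul, limFun_lim, limFun_lim]

lemma starFourier_limFun (f : Finset U → ℝ → ℂ) (hf : L.Qualified {s | Integrable (f s)}) :
    L.starFourier (L.limFun f) = L.limFun fun s => unitaryFourier (f s) := by
  funext ξ
  obtain ⟨k, rfl⟩ := L.lim_surjective ξ
  rw [starFourier, ← L.lim_neg, planeWave_lim,
    L.starIntegral_mul _ _ (hf.mono L fun s hs => integrable_mul_exp hs _), invSqrtTwoPi,
    limC_smul, limFun_lim]
  rfl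

/-! ### Ultrafunctions -/

variable (ι : (ℝ → ℂ) ↪ U)

lemma spanIn_le (s : Finset U) : spanIn ι s ≤ fourierSpace :=
  Submodule.span_le.2 fun _ hf => hf.1

lemma finiteDimensional_spanIn (s : Finset U) : FiniteDimensional ℂ (spanIn ι s) :=
  FiniteDimensional.span_of_finite ℂ
    ((s.finite_toSet.preimage ι.injective.injOn).subset fun _ hf => hf.2)

lemma natExt_mem_ultrafunctions {u : ℝ → ℂ} (hu : u ∈ fourierSpace) :
    L.natExt u ∈ L.ultrafunctions ι := by
  classical
  refine ⟨fun s => if ι u ∈ s then u else 0, fun s => ?_, L.limFun_congr ?_⟩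
  · dsimp only
    split_ifs with h
    exacts [Submodule.subset_span ⟨hu, h⟩, Submodule.zero_mem _]
  · exact (L.qualified_superset {ι u}).mono L fun s hs => if_pos (hs (Finset.mem_singleton_self _))

lemma limFun_mem_ultrafunctions {f : Finset U → ℝ → ℂ}
    (hf : L.Qualified {s | f s ∈ spanIn ι s}) : L.limFun f ∈ L.ultrafunctions ι := by
  classical
  refine ⟨fun s => if f s ∈ spanIn ι s then f s else 0, fun s => ?_, L.limFun_congr ?_⟩
  · dsimp only
    split_ifs with h
    exacts [h, Submodule.zero_mem _]
  · exact hf.mono L fun s hs => if_pos hs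

/-- Internal functions determine their nets on a qualified set, so membership in the limit space
descends to the `V_s`. -/
lemma qualified_mem_of_limFun_mem {f : Finset U → ℝ → ℂ} (h : L.limFun f ∈ L.ultrafunctions ι) :
    L.Qualified {s | f s ∈ spanIn ι s} := by
  obtain ⟨g, hg, hgf⟩ := h
  refine (L.qualified_of_limFun_eq hgf).mono L fun s hs => ?_
  have hs' : g s = f s := hs
  rw [Set.mem_ofPred_eq, ← hs']
  exact hg s

variable {ι}

/-- The axiom speaks of one ultrafunction at a time; applying it to arbitrary nets makes closure
uniform over all of `V_s` for qualified many `s`. -/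
lemma qualified_fourierClosed (hF : L.FourierTransformAxiom ι) :
    L.Qualified {s | FourierClosed (spanIn ι s)} := by
  have h : L.Qualified {s | ∀ f : ℝ → ℂ, f ∈ spanIn ι s →
      unitaryFourier f ∈ spanIn ι s ∧ (fun x => star (f x)) ∈ spanIn ι s} := by
    classical
    refine L.qualified_forall fun f => ?_
    -- Replacing values outside `V_s` by 0 makes any net define an ultrafunction.
    let g : Finset U → ℝ → ℂ := fun s => if f s ∈ spanIn ι s then f s else 0
    have hg : ∀ s, g s ∈ spanIn ι s := fun s => by
      dsimp only [g]
      split_ifs with h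
      exacts [h, Submodule.zero_mem _]
    obtain ⟨h1, h2⟩ := hF _ ⟨g, hg, rfl⟩
    rw [L.starFourier_limFun _ (L.qualified_of_forall fun s =>
      integrable_of_mem_fourierSpace (spanIn_le ι s (hg s)))] at h1
    rw [limFun_star] at h2
    refine ((L.qualified_mem_of_limFun_mem ι h1).inter L
      (L.qualified_mem_of_limFun_mem ι h2)).mono L fun s hs hf => ?_
    have hgf : g s = f s := if_pos hf
    rw [← hgf]
    exact hs
  exact h.mono L fun s hs => ⟨spanIn_le ι s, finiteDimensional_spanIn ι s,
    fun f hf => (hs f hf).2, fun f hf => (hs f hf).1⟩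

lemma starIntegral_mul_of_mem {f g : Finset U → ℝ → ℂ} (hf : L.Qualified {s | f s ∈ spanIn ι s})
    (hg : L.Qualified {s | g s ∈ spanIn ι s}) :
    L.starIntegral (fun x => L.limFun f x * L.limFun g x) = L.limC fun s => ∫ x, f s x * g s x :=
  L.starIntegral_mul _ _ <| (hf.inter L hg).mono L fun s hs =>
    integrable_mul_of_mem_fourierSpace (spanIn_le ι s hs.1) (spanIn_le ι s hs.2)

/-- Nondegeneracy of the pairing in the limit. It gives uniqueness of `δ_q` and of the projected
plane waves, so the epsilon choices are unambiguous. -/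
lemma eq_of_starIntegral_mul (hF : L.FourierTransformAxiom ι) {u w : K → HyperComplex K}
    (hu : u ∈ L.ultrafunctions ι) (hw : w ∈ L.ultrafunctions ι)
    (h : ∀ v ∈ L.ultrafunctions ι, L.starIntegral (fun x => v x * u x) =
      L.starIntegral (fun x => v x * w x)) : u = w := by
  obtain ⟨f, hf, rfl⟩ := hu
  obtain ⟨g, hg, rfl⟩ := hw
  have hq : L.Qualified {s | ∀ v : ℝ → ℂ, v ∈ spanIn ι s →
      ∫ x, v x * f s x = ∫ x, v x * g s x} := by
    classical
    refine L.qualified_forall fun v => ?_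
    let v' : Finset U → ℝ → ℂ := fun s => if v s ∈ spanIn ι s then v s else 0
    have hv : ∀ s, v' s ∈ spanIn ι s := fun s => by
      dsimp only [v']
      split_ifs with h
      exacts [h, Submodule.zero_mem _]
    have h1 := h _ ⟨v', hv, rfl⟩
    rw [L.starIntegral_mul_of_mem (L.qualified_of_forall hv) (L.qualified_of_forall hf),
      L.starIntegral_mul_of_mem (L.qualified_of_forall hv) (L.qualified_of_forall hg)] at h1
    refine (L.qualified_of_limC_eq h1).mono L fun s hs hvs => ?_
    have hvv : v' s = v s := if_pos hvs
    rw [← hvv]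
    exact hs
  exact L.limFun_congr <| (hq.inter L (L.qualified_fourierClosed hF)).mono L fun s hs =>
    hs.2.eq_of_integral_mul (hf s) (hg s) hs.1

lemma isDelta_limFun (hF : L.FourierTransformAxiom ι) (q : Finset U → ℝ) :
    L.IsDelta ι (L.lim q) (L.limFun fun s => deltaIn (spanIn ι s) (q s)) := by
  refine ⟨⟨_, fun s => deltaIn_mem _ _, rfl⟩, ?_⟩
  rintro _ ⟨v, hv, rfl⟩
  rw [L.starIntegral_mul_of_mem (L.qualified_of_forall hv)
    (L.qualified_of_forall fun s => deltaIn_mem _ _), limFun_lim]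
  exact L.limC_congr <| (L.qualified_fourierClosed hF).mono L fun s hs =>
    hs.integral_mul_deltaIn _ (hv s)

lemma delta_lim (hF : L.FourierTransformAxiom ι) (q : Finset U → ℝ) :
    L.delta ι (L.lim q) = L.limFun fun s => deltaIn (spanIn ι s) (q s) := by
  have h := L.isDelta_limFun hF q
  have h' : L.IsDelta ι (L.lim q) (L.delta ι (L.lim q)) := Classical.epsilon_spec ⟨_, h⟩
  exact L.eq_of_starIntegral_mul hF h'.1 h.1 fun v hv => (h'.2 v hv).trans (h.2 v hv).symm

lemma isTilde_limFun (hF : L.FourierTransformAxiom ι) (k : Finset U → ℝ) :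
    L.IsTilde ι (L.planeWave (L.lim k)) (L.limFun fun s x =>
      (Real.sqrt (2 * Real.pi) : ℂ) * unitaryFourierInv (deltaIn (spanIn ι s) (k s)) x) := by
  have hmem : L.Qualified {s | (fun x => (Real.sqrt (2 * Real.pi) : ℂ) *
      unitaryFourierInv (deltaIn (spanIn ι s) (k s)) x) ∈ spanIn ι s} :=
    (L.qualified_fourierClosed hF).mono L fun s hs =>
      Submodule.smul_mem _ _ (hs.fourierInv_mem (deltaIn_mem _ _))
  refine ⟨L.limFun_mem_ultrafunctions ι hmem, ?_⟩
  rintro _ ⟨v, hv, rfl⟩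
  rw [L.starIntegral_mul_of_mem hmem (L.qualified_of_forall hv), planeWave_lim,
    L.starIntegral_mul]
  · exact L.limC_congr <| (L.qualified_fourierClosed hF).mono L fun s hs =>
      hs.integral_exp_mul _ (hv s)
  · refine (L.qualified_fourierClosed hF).mono L fun s hs => ?_
    refine (integrable_mul_exp (hs.integrable (hv s)) (k s)).congr (Eventually.of_forall fun x => ?_)
    exact mul_comm _ _

lemma tilde_planeWave_lim (hF : L.FourierTransformAxiom ι) (k : Finset U → ℝ) :
    L.tilde ι (L.planeWave (L.lim k)) = L.limFun fun s x =>
      (Real.sqrt (2 * Real.pi) : ℂ) * unitaryFourierInv (deltaIn (spanIn ι s) (k s)) x := by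
  have h := L.isTilde_limFun hF k
  have h' : L.IsTilde ι (L.planeWave (L.lim k)) (L.tilde ι (L.planeWave (L.lim k))) :=
    Classical.epsilon_spec ⟨_, h⟩
  refine L.eq_of_starIntegral_mul hF h'.1 h.1 fun v hv => ?_
  simp only [mul_comm (v _)]
  exact (h'.2 v hv).symm.trans (h.2 v hv)

lemma smul_tilde_planeWave_lim (hF : L.FourierTransformAxiom ι) (k : Finset U → ℝ) :
    (fun x => invSqrtTwoPi K • L.tilde ι (L.planeWave (L.lim k)) x) =
      L.limFun fun s => unitaryFourierInv (deltaIn (spanIn ι s) (k s)) := by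
  have hs : (Real.sqrt (2 * Real.pi) : ℝ) ≠ 0 := by positivity
  rw [L.tilde_planeWave_lim hF, invSqrtTwoPi, limFun_smul]
  congr 1
  funext s x
  rw [← mul_assoc, ← Complex.ofReal_mul, one_div_mul_cancel hs, Complex.ofReal_one, one_mul]

lemma qualified_mem_of_lim_mem {A : Finset U → Finset ℝ} {a : Finset U → ℝ}
    (h : L.lim a ∈ L.limSet A) : L.Qualified {s | a s ∈ A s} := by
  obtain ⟨x, hx, hxa⟩ := h
  refine (hx.inter L (L.qualified_of_lim_eq hxa)).mono L fun s hs => ?_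
  have h1 : x s = a s := hs.2
  rw [Set.mem_ofPred_eq, ← h1]
  exact hs.1

lemma lim_mem_limSet {A : Finset U → Finset ℝ} {a : Finset U → ℝ}
    (h : L.Qualified {s | a s ∈ A s}) : L.lim a ∈ L.limSet A := ⟨a, h, rfl⟩

/-- The given finite-level bases are only known to have the Delta ultrafunctions as limits; on a
qualified set they must coincide with `deltaIn`. -/
lemma IsIndependentPoints.exists_isBasisOn (hF : L.FourierTransformAxiom ι) {S : Set K}
    (hS : L.IsIndependentPoints ι S) : ∃ A : Finset U → Finset ℝ, L.limSet A = S ∧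
      L.Qualified {s | IsBasisOn (spanIn ι s) (A s) (deltaIn (spanIn ι s))} := by
  classical
  obtain ⟨A, β, hA, hβ, hq⟩ := hS
  refine ⟨A, hA, ?_⟩
  have h : L.Qualified {s | ∀ t ∈ A s, β s t = deltaIn (spanIn ι s) t} := by
    rcases L.qualified_or_compl {s | (A s).Nonempty} with hne | he
    · refine L.qualified_forall fun t => ?_
      -- The net is forced into `A s`, so that its limit lies in `S`. This needs `A s` nonempty;
      -- where it is empty the claim is vacuous.
      let t' : Finset U → ℝ := fun s =>
        if t s ∈ A s then t s else if h : (A s).Nonempty then h.choose else 0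
      have ht' : L.lim t' ∈ S := hA ▸ L.lim_mem_limSet (hne.mono L fun s hs => by
        have hs' : (A s).Nonempty := hs
        simp only [t', Set.mem_ofPred_eq]
        split_ifs with h1
        exacts [h1, hs'.choose_spec])
      have h1 := (hβ t' ht').symm.trans (L.delta_lim hF t')
      refine (L.qualified_of_limFun_eq h1).mono L fun s hs ht => ?_
      have h2 : t' s = t s := if_pos ht
      rw [← h2]
      exact hs
    · exact he.mono L fun s hs t ht => absurd ⟨t, ht⟩ hs
  exact (h.inter L hq).mono L fun s hs =>
    IsBasisOn.congr (d := β s) ⟨hs.2.1, hs.2.2⟩ hs.1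

/-! ### The dual basis and the expansion in the limit. -/

section Basis

variable {S : Set K} {A : Finset U → Finset ℝ}

lemma isHyperBasis_of_isBasisOn {b : K → K → HyperComplex K} {β : Finset U → ℝ → ℝ → ℂ}
    (hA : L.limSet A = S)
    (hb : ∀ a : Finset U → ℝ, L.lim a ∈ S → b (L.lim a) = L.limFun fun s => β s (a s))
    (hβ : L.Qualified {s | IsBasisOn (spanIn ι s) (A s) (β s)}) : L.IsHyperBasis ι S b :=
  ⟨A, β, hA, hb, hβ⟩

/-- Points of `A s` where the nets differ would form a net with limit in `S` at which `u` and `w`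
differ. -/
lemma eq_of_forall_mem (hF : L.FourierTransformAxiom ι) (hA : L.limSet A = S)
    (hq : L.Qualified {s | IsBasisOn (spanIn ι s) (A s) (deltaIn (spanIn ι s))})
    {u w : K → HyperComplex K} (hu : u ∈ L.ultrafunctions ι) (hw : w ∈ L.ultrafunctions ι)
    (h : ∀ a ∈ S, u a = w a) : u = w := by
  classical
  obtain ⟨f, hf, rfl⟩ := hu
  obtain ⟨g, hg, rfl⟩ := hw
  have h1 : L.Qualified {s | ∀ t ∈ A s, f s t = g s t} := by
    rcases L.qualified_or_compl {s | ∀ t ∈ A s, f s t = g s t} with hq | hq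
    · exact hq
    exfalso
    let x : Finset U → ℝ := fun s => if hs : ∃ t, t ∈ A s ∧ f s t ≠ g s t then hs.choose else 0
    have hx : ∀ s ∈ {s | ∀ t ∈ A s, f s t = g s t}ᶜ, x s ∈ A s ∧ f s (x s) ≠ g s (x s) := by
      intro s hs
      have hex : ∃ t, t ∈ A s ∧ f s t ≠ g s t := by
        simpa using hs
      have hxs : x s = hex.choose := dif_pos hex
      rw [hxs]
      exact hex.choose_spec
    have heq := h _ (hA ▸ L.lim_mem_limSet (hq.mono L fun s hs => (hx s hs).1) : L.lim x ∈ S)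
    rw [limFun_lim, limFun_lim] at heq
    exact L.not_qualified_empty
      ((hq.inter L (L.qualified_of_limC_eq heq)).mono L fun s hs => (hx s hs.1).2 hs.2)
  exact L.limFun_congr <| ((h1.inter L hq).inter L (L.qualified_fourierClosed hF)).mono L
    fun s hs => hs.2.eq_of_forall_mem hs.1.2 (hf s) (hg s) hs.1.1

lemma isSigma_limFun (hF : L.FourierTransformAxiom ι) (hA : L.limSet A = S)
    (hq : L.Qualified {s | IsBasisOn (spanIn ι s) (A s) (deltaIn (spanIn ι s))})
    (b : Finset U → ℝ) :
    L.IsSigma ι S (L.lim b) (L.limFun fun s => sigmaIn (spanIn ι s) (A s) (b s)) := by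
  refine ⟨⟨_, fun s => sigmaIn_mem _ _ _, rfl⟩, fun ξ hξ => ?_⟩
  obtain ⟨a, rfl⟩ := L.lim_surjective ξ
  have ha := L.qualified_mem_of_lim_mem (hA.symm ▸ hξ : L.lim a ∈ L.limSet A)
  rw [L.delta_lim hF, L.starIntegral_mul_of_mem (L.qualified_of_forall fun s => deltaIn_mem _ _)
    (L.qualified_of_forall fun s => sigmaIn_mem _ _ _), ← limC_ite]
  exact L.limC_congr <| ((ha.inter L hq).inter L (L.qualified_fourierClosed hF)).mono L
    fun s hs => hs.2.integral_deltaIn_mul_sigmaIn hs.1.2 hs.1.1 _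

/-- Duality with `δ_a` prescribes the value at each `a ∈ S`, and an ultrafunction is determined by
its values on `S`. -/
lemma sigma_lim (hF : L.FourierTransformAxiom ι) (hA : L.limSet A = S)
    (hq : L.Qualified {s | IsBasisOn (spanIn ι s) (A s) (deltaIn (spanIn ι s))})
    (b : Finset U → ℝ) :
    L.sigma ι S (L.lim b) = L.limFun fun s => sigmaIn (spanIn ι s) (A s) (b s) := by
  have h := L.isSigma_limFun hF hA hq b
  have h' : L.IsSigma ι S (L.lim b) (L.sigma ι S (L.lim b)) := Classical.epsilon_spec ⟨_, h⟩
  refine L.eq_of_forall_mem hF hA hq h'.1 h.1 fun a ha => ?_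
  have hd : L.IsDelta ι a (L.delta ι a) := by
    obtain ⟨q, rfl⟩ := L.lim_surjective a
    exact Classical.epsilon_spec ⟨_, L.isDelta_limFun hF q⟩
  rw [← hd.2 _ h'.1, ← hd.2 _ h.1]
  simp only [mul_comm _ (L.delta ι a _)]
  exact (h'.2 a ha).trans (h.2 a ha).symm

lemma starFourier_sigma_lim (hF : L.FourierTransformAxiom ι) (hA : L.limSet A = S)
    (hq : L.Qualified {s | IsBasisOn (spanIn ι s) (A s) (deltaIn (spanIn ι s))})
    (b : Finset U → ℝ) :
    (fun x => L.starFourier (L.sigma ι S (L.lim b)) (-x)) =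
      L.limFun fun s => unitaryFourierInv (sigmaIn (spanIn ι s) (A s) (b s)) := by
  rw [L.sigma_lim hF hA hq, L.starFourier_limFun, limFun_neg]
  · rfl
  · exact L.qualified_of_forall fun s =>
      integrable_of_mem_fourierSpace (spanIn_le ι s (sigmaIn_mem _ _ _))

lemma hasFourierExpansion (hF : L.FourierTransformAxiom ι) (hA : L.limSet A = S)
    (hq : L.Qualified {s | IsBasisOn (spanIn ι s) (A s) (deltaIn (spanIn ι s))})
    {u : K → HyperComplex K} (hu : u ∈ L.ultrafunctions ι) : L.HasFourierExpansion ι S u := by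
  obtain ⟨f, hf, rfl⟩ := hu
  intro ξ
  obtain ⟨x, rfl⟩ := L.lim_surjective ξ
  -- The factor `√(2π)` stays in the summand, because the projected wave is not normalized; the
  -- outer `1/√(2π)` cancels it at the end.
  refine ⟨_, ⟨A, fun s t => (∫ y, unitaryFourier (f s) y * sigmaIn (spanIn ι s) (A s) t y) *
    ((Real.sqrt (2 * Real.pi) : ℂ) * unitaryFourierInv (deltaIn (spanIn ι s) t) (x s)), hA,
    fun κ _ => ?_, rfl⟩, ?_⟩
  · obtain ⟨k, rfl⟩ := L.lim_surjective κ
    dsimp only [fourierCoeff]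
    rw [L.sigma_lim hF hA hq, L.starFourier_limFun _ (L.qualified_of_forall fun s =>
      integrable_of_mem_fourierSpace (spanIn_le ι s (hf s))),
      L.starIntegral_mul_of_mem (ι := ι), L.tilde_planeWave_lim hF, limFun_lim, limFun_lim,
      limC_mul]
    · exact (L.qualified_fourierClosed hF).mono L fun s hs => hs.fourier_mem _ (hf s)
    · exact L.qualified_of_forall fun s => sigmaIn_mem _ _ _
  · have hs0 : (Real.sqrt (2 * Real.pi) : ℝ) ≠ 0 := by positivity
    rw [invSqrtTwoPi, limC_smul, limFun_lim]
    refine L.limC_congr <| (hq.inter L (L.qualified_fourierClosed hF)).mono L fun s hs => ?_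
    have h := congrFun (hs.2.expansion hs.1 (hf s)) (x s)
    simp only [Finset.sum_apply, Pi.smul_apply, smul_eq_mul] at h
    rw [Set.mem_ofPred_eq, h, Finset.mul_sum]
    refine Finset.sum_congr rfl fun t _ => ?_
    rw [mul_left_comm, ← mul_assoc (Complex.ofReal _), ← Complex.ofReal_mul,
      one_div_mul_cancel hs0, Complex.ofReal_one, one_mul]

end Basis

end LambdaLimit

/-! ### The Fourier expansion theorem. -/

theorem mainTheorem11 {U K : Type*} [Field K] [LinearOrder K] [IsStrictOrderedRing K]
    [Algebra ℝ K] (L : LambdaLimit U K) (ι : (ℝ → ℂ) ↪ U) (hF : L.FourierTransformAxiom ι)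
    (S : Set K) (hS : L.IsIndependentPoints ι S) :
    (∀ u ∈ fourierSpace,
      L.natExt u ∈ L.ultrafunctions ι ∧ L.HasFourierExpansion ι S (L.natExt u)) ∧
    (∀ u ∈ L.ultrafunctions ι, L.HasFourierExpansion ι S u) ∧
    L.IsHyperBasis ι S (fun k x => LambdaLimit.invSqrtTwoPi K • L.tilde ι (L.planeWave k) x) ∧
    L.IsHyperBasis ι S (fun k x => L.starFourier (L.sigma ι S k) (-x)) ∧
    (∀ k ∈ S, ∀ b ∈ S,
      L.scalarProduct (fun x => LambdaLimit.invSqrtTwoPi K • L.tilde ι (L.planeWave k) x)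
        (fun x => L.starFourier (L.sigma ι S b) (-x)) = LambdaLimit.kronecker k b) := by
  obtain ⟨A, hA, hq⟩ := LambdaLimit.IsIndependentPoints.exists_isBasisOn L hF hS
  have hC := L.qualified_fourierClosed hF
  refine ⟨fun u hu => ?_, fun u hu => L.hasFourierExpansion hF hA hq hu, ?_, ?_, ?_⟩
  · have h := L.natExt_mem_ultrafunctions ι hu
    exact ⟨h, L.hasFourierExpansion hF hA hq h⟩
  · exact L.isHyperBasis_of_isBasisOn hA (fun a _ => L.smul_tilde_planeWave_lim hF a)
      ((hq.inter L hC).mono L fun s hs => hs.2.isBasisOn_fourierInv hs.1)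
  · exact L.isHyperBasis_of_isBasisOn hA (fun a _ => L.starFourier_sigma_lim hF hA hq a)
      ((hq.inter L hC).mono L fun s hs => hs.2.isBasisOn_fourierInv (hs.2.isBasisOn_sigmaIn hs.1))
  · intro κ hκ η _
    obtain ⟨k, rfl⟩ := L.lim_surjective κ
    obtain ⟨b, rfl⟩ := L.lim_surjective η
    have hk := L.qualified_mem_of_lim_mem (hA.symm ▸ hκ : L.lim k ∈ L.limSet A)
    have h1 := L.smul_tilde_planeWave_lim hF k
    have h2 := L.starFourier_sigma_lim hF hA hq b
    rw [h1, h2, LambdaLimit.scalarProduct]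
    -- Conjugation is absorbed into the net, so that the scalar product becomes the integral of a
    -- product of two limits.
    have h3 := L.limFun_star fun s =>
      unitaryFourierInv (sigmaIn (LambdaLimit.spanIn ι s) (A s) (b s))
    rw [show (fun x => L.limFun (fun s => unitaryFourierInv (deltaIn (LambdaLimit.spanIn ι s) (k s))) x
      * star (L.limFun (fun s =>
        unitaryFourierInv (sigmaIn (LambdaLimit.spanIn ι s) (A s) (b s))) x)) = _ from
      funext fun x => congrArg _ (congrFun h3 x),
      L.starIntegral_mul_of_mem (ι := ι), ← L.limC_ite]
    · exact L.limC_congr <| ((hk.inter L hq).inter L hC).mono L fun s hs =>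
        hs.2.integral_fourierInv_mul_star hs.1.2 hs.1.1 _
    · exact hC.mono L fun s hs => hs.fourierInv_mem (deltaIn_mem _ _)
    · exact hC.mono L fun s hs => hs.star_mem _ (hs.fourierInv_mem (sigmaIn_mem _ _ _))
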